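/- Let $n\ge 1$, let $\overline N=\mathbb Z^{n-1}$ with standard basis $e_1,\dots,e_{n-1}$, let $\overline M=\mathbb Z^{n-1}$ be its dual, and put $N=\mathbb Z\oplus\overline N\oplus\mathbb Z$, with dual $M=\mathbb Z\oplus\overline M\oplus\mathbb Z$. Let the symmetric group $\mathfrak S_n$ act linearly on $N$ by $$s\cdot(a,w,c)=\bigl(a-w_{s^{-1}(n)},\ (w_{s^{-1}(i)}-w_{s^{-1}(n)})_{1\le i\le n-1},\ c+w_{s^{-1}(n)}\bigr),\qquad w_n:=0 .$$ Thus $(k\ \,k{+}1)$ with $k\le n-2$ interchanges $w_k$ and $w_{k+1}$, and $(n{-}1\ \,n)$ sends $(a,w,c)$ to $(a-w_{n-1},\,(w_1-w_{n-1},\dots,w_{n-2}-w_{n-1},-w_{n-1}),\,c+w_{n-1})$. Let $\delta^{(n)}\subset N_{\mathbb R}$ be the cone generated by the vectors $(1,\,e_1+\dots+e_j,\,0)$ for $0\le j\le n-1$ and by $(0,0,1)$. Let $\Delta^{(n)}$ be the set of all faces of the cones $s\,\delta^{(n)}$, $s\in\mathfrak S_n$, let $\sigma^{(n)}=\bigcup_{s}s\,\delta^{(n)}$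 be its support, and let $\sigma^{(n)\vee}\subset M_{\mathbb R}$ be the dual cone. Let $$P^{(n)}=\operatorname{conv}\{(s(1)-1,\dots,s(n-1)-(n-1))\mid s\in\mathfrak S_n\}\subset\overline M_{\mathbb R}$$ be the permutahedron, let $\iota:\overline M_{\mathbb R}\to M_{\mathbb R}$ be the inclusion of the middle summand, and put $\tilde P^{(n)}=\sigma^{(n)\vee}+\iota P^{(n)}$. Then the (inner) normal fan of the polyhedron $\tilde P^{(n)}$, that is, the set of the normal cones of its nonempty faces, is $\Delta^{(n)}$. In particular, it is a fan (a finite set of strongly convex rational polyhedral cones, closed under taking faces, in which any two cones intersect in a common face). The complex toric variety $X(\tilde P^{(n)})$, which is by definition the toric variety of the normal fan of $\tilde P^{(n)}$, is isomorphic to the toric variety $\tilde Z^{(n)\prime}=X(\Delta^{(n)})$, by an isomorphism over $\operatorname{Spec}\mathbb C$ that restricts to the identity on the torus $\operatorname{Spec}\mathbb C[M]$. -/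

import Mathlib

open CategoryTheory CategoryTheory.Limits AlgebraicGeometry
open scoped Pointwise

noncomputable section

namespace Toric

/-! ### Rational polyhedral cones and fans

The lattices `N` and `M = Hom(N, ℤ)` are both written as `ι → ℤ`, the real vector spaces `N_ℝ` and
`M_ℝ` as `ι → ℝ`, and the perfect pairing between them is the dot product `⬝ᵥ`. -/

section Fans

variable {ι : Type} [Fintype ι]

/-- The inclusion of the lattice `ℤ^ι` into the real vector space `ℝ^ι`. -/
def toReal (m : ι → ℤ) : ι → ℝ := fun i => (m i : ℝ)

/-- A rational polyhedral cone: generated by finitely many lattice vectors. -/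
def IsRationalPolyhedral (σ : PointedCone ℝ (ι → ℝ)) : Prop :=
  ∃ S : Finset (ι → ℤ), σ = PointedCone.hull ℝ (toReal '' (S : Set (ι → ℤ)))

/-- `τ` is a face of the cone `σ`: `τ = σ ∩ m^⊥` for some `m` in the dual cone of `σ`. -/
def IsFace (τ σ : PointedCone ℝ (ι → ℝ)) : Prop :=
  ∃ m : ι → ℝ, (∀ u ∈ σ, 0 ≤ m ⬝ᵥ u) ∧ ∀ u, u ∈ τ ↔ u ∈ σ ∧ m ⬝ᵥ u = 0

/-- A fan: a finite collection of strongly convex rational polyhedral cones which is closed under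
taking faces and in which any two cones intersect in a common face. -/
structure IsFan (C : Set (PointedCone ℝ (ι → ℝ))) : Prop where
  finite : C.Finite
  rational : ∀ σ ∈ C, IsRationalPolyhedral σ
  stronglyConvex : ∀ σ ∈ C, ∀ u ∈ σ, -u ∈ σ → u = 0
  face_mem : ∀ σ ∈ C, ∀ τ, IsFace τ σ → τ ∈ C
  inter_face : ∀ σ ∈ C, ∀ τ ∈ C, IsFace (σ ⊓ τ) σ ∧ IsFace (σ ⊓ τ) τ

variable (ι) in
/-- A fan in `ℝ^ι` with respect to the lattice `ℤ^ι`. -/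
structure Fan where
  cones : Set (PointedCone ℝ (ι → ℝ))
  isFan : IsFan cones

/-- The normal cone of a subset `Q` of `P`: all `u` which, as linear functionals on `P`, attain
their minimum at every point of `Q`. -/
def normalCone (P Q : Set (ι → ℝ)) : PointedCone ℝ (ι → ℝ) where
  carrier := {u | ∀ q ∈ Q, ∀ p ∈ P, q ⬝ᵥ u ≤ p ⬝ᵥ u}
  zero_mem' := by simp
  add_mem' := by
    intro a b ha hb q hq p hp
    simp only [dotProduct_add]
    exact add_le_add (ha q hq p hp) (hb q hq p hp)
  smul_mem' := by
    intro c a ha q hq p hp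
    have h : ∀ x : ι → ℝ, x ⬝ᵥ (c • a) = (c : ℝ) * (x ⬝ᵥ a) := fun x => by
      rw [← smul_eq_mul, ← dotProduct_smul]; rfl
    rw [h, h]
    exact mul_le_mul_of_nonneg_left (ha q hq p hp) c.2

/-- The (inner) normal fan of a polyhedron `P`: the normal cones of all nonempty faces of `P`, where
a face is the set of points of `P` at which some linear functional is extremal. -/
def normalFan (P : Set (ι → ℝ)) : Set (PointedCone ℝ (ι → ℝ)) :=
  {σ | ∃ Q : Set (ι → ℝ), Q.Nonempty ∧ IsExposed ℝ P Q ∧ σ = normalCone P Q}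

end Fans

/-! ### The toric variety of a fan -/

section ToricVariety

variable {ι : Type} [Fintype ι]

/-- The semigroup `σ^∨ ∩ M`. -/
def dualMonoid (σ : PointedCone ℝ (ι → ℝ)) : AddSubmonoid (ι → ℤ) where
  carrier := {m | ∀ u ∈ σ, 0 ≤ toReal m ⬝ᵥ u}
  zero_mem' := by
    intro u _
    have : toReal (0 : ι → ℤ) = 0 := by ext; simp [toReal]
    simp [this]
  add_mem' := by
    intro a b ha hb u hu
    have : toReal (a + b) = toReal a + toReal b := by ext; simp [toReal]
    rw [this, add_dotProduct]
    exact add_nonneg (ha u hu) (hb u hu)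

lemma dualMonoid_anti {τ σ : PointedCone ℝ (ι → ℝ)} (h : τ ≤ σ) :
    dualMonoid σ ≤ dualMonoid τ :=
  fun _ hm u hu => hm u (h hu)

/-- The affine toric variety `U_σ = Spec ℂ[σ^∨ ∩ M]`. -/
abbrev affineToric (σ : PointedCone ℝ (ι → ℝ)) : Scheme.{0} :=
  Spec (CommRingCat.of (AddMonoidAlgebra ℂ (dualMonoid σ)))

/-- The ring map `ℂ[σ^∨ ∩ M] → ℂ[τ^∨ ∩ M]` for cones `τ ⊆ σ`. -/
def dualMap {τ σ : PointedCone ℝ (ι → ℝ)} (h : τ ≤ σ) :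
    AddMonoidAlgebra ℂ (dualMonoid σ) →+* AddMonoidAlgebra ℂ (dualMonoid τ) :=
  AddMonoidAlgebra.mapDomainRingHom ℂ (AddSubmonoid.inclusion (dualMonoid_anti h))

/-- The gluing diagram of a collection of cones: the affine toric varieties `U_σ`, with the
morphisms `U_τ ⟶ U_σ` for `τ ⊆ σ` (in a fan: for `τ` a face of `σ`). -/
def gluingDiagram (C : Set (PointedCone ℝ (ι → ℝ))) : C ⥤ Scheme.{0} where
  obj σ := affineToric σ.1
  map f := Spec.map (CommRingCat.ofHom (dualMap (leOfHom f)))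
  map_id σ := by
    rw [← Spec.map_id]
    exact congrArg (fun g => Spec.map (CommRingCat.ofHom g))
      (AddMonoidAlgebra.mapDomainRingHom_id (R := ℂ) (M := dualMonoid σ.1))
  map_comp f g := by
    rw [← Spec.map_comp, ← CommRingCat.ofHom_comp, dualMap, dualMap, dualMap,
      ← AddMonoidAlgebra.mapDomainRingHom_comp]
    rfl

/-! The next lemmas show that in a fan the maps of the gluing diagram are open immersions and that
the diagram is locally directed, so that its colimit exists and is the gluing of the `U_σ`. -/

/-- A linear inequality system with integral coefficients that has a real solution has an integral
solution with the same sign pattern. -/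
lemma exists_integral (S : Finset (ι → ℤ)) (m : ι → ℝ) (hm : ∀ g ∈ S, 0 ≤ m ⬝ᵥ toReal g) :
    ∃ m' : ι → ℤ, ∀ g ∈ S, 0 ≤ toReal m' ⬝ᵥ toReal g ∧
      (toReal m' ⬝ᵥ toReal g = 0 ↔ m ⬝ᵥ toReal g = 0) := by
  classical
  let V : Submodule ℚ ℝ := Submodule.span ℚ (Set.range m)
  have hmV : ∀ i, m i ∈ V := fun i => Submodule.subset_span ⟨i, rfl⟩
  have : FiniteDimensional ℚ V := FiniteDimensional.span_of_finite ℚ (Set.finite_range m)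
  let b := Module.finBasis ℚ V
  let c : ι → Fin (Module.finrank ℚ V) → ℚ := fun i => b.repr ⟨m i, hmV i⟩
  have hc : ∀ i, m i = ∑ j, (c i j : ℝ) * (b j : ℝ) := by
    intro i
    have h := congrArg Subtype.val (b.sum_repr ⟨m i, hmV i⟩)
    simp only [Submodule.coe_sum, Submodule.coe_smul] at h
    rw [← h]
    exact Finset.sum_congr rfl fun j _ => Rat.smul_def _ _
  let L : (ι → ℤ) → Fin (Module.finrank ℚ V) → ℚ := fun g j => ∑ i, c i j * g i
  have hL : ∀ (g : ι → ℤ) (x : Fin (Module.finrank ℚ V) → ℝ),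
      (fun i => ∑ j, (c i j : ℝ) * x j) ⬝ᵥ toReal g = ∑ j, (L g j : ℝ) * x j := by
    intro g x
    simp only [dotProduct, toReal, L, Rat.cast_sum, Rat.cast_mul, Rat.cast_intCast,
      Finset.sum_mul]
    rw [Finset.sum_comm]
    exact Finset.sum_congr rfl fun j _ => Finset.sum_congr rfl fun i _ => by ring
  have hmL : ∀ g : ι → ℤ, m ⬝ᵥ toReal g = ∑ j, (L g j : ℝ) * (b j : ℝ) := by
    intro g
    rw [← hL, ← funext hc]
  let U : Set (Fin (Module.finrank ℚ V) → ℝ) :=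
    {x | ∀ g ∈ S, 0 < m ⬝ᵥ toReal g → 0 < ∑ j, (L g j : ℝ) * x j}
  have hU : IsOpen U := by
    have : U = ⋂ g ∈ S, {x | 0 < m ⬝ᵥ toReal g → 0 < ∑ j, (L g j : ℝ) * x j} := by
      ext x; simp [U]
    rw [this]
    refine isOpen_biInter_finset fun g _ => ?_
    by_cases h : 0 < m ⬝ᵥ toReal g
    · simp only [h, true_imp_iff]
      exact isOpen_lt continuous_const (by fun_prop)
    · simp [h]
  have hd : DenseRange (fun q : Fin (Module.finrank ℚ V) → ℚ => fun j => (q j : ℝ)) :=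
    DenseRange.piMap fun _ => Rat.denseRange_cast
  obtain ⟨q, hq⟩ := hd.exists_mem_open hU ⟨fun j => (b j : ℝ), fun g _ h => by rwa [← hmL]⟩
  let p : ι → ℚ := fun i => ∑ j, c i j * q j
  have hp : ∀ g : ι → ℤ, (fun i => (p i : ℝ)) ⬝ᵥ toReal g = ∑ j, (L g j : ℝ) * (q j : ℝ) := by
    intro g
    rw [← hL]
    congr 1
    ext i
    simp [p]
  let D : ℕ := ∏ i, (p i).den
  have hD : 0 < D := Finset.prod_pos fun i _ => (p i).den_pos
  have hint : ∀ i, ∃ z : ℤ, (z : ℝ) = D * (p i : ℝ) := by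
    intro i
    obtain ⟨k, hk⟩ : (p i).den ∣ D := Finset.dvd_prod_of_mem _ (Finset.mem_univ i)
    refine ⟨k * (p i).num, ?_⟩
    have h : ((p i).den : ℝ) * (p i : ℝ) = (p i).num := by
      exact_mod_cast Rat.den_mul_eq_num (p i)
    rw [hk]
    push_cast
    rw [← h]
    ring
  choose z hz using hint
  have hzg : ∀ g : ι → ℤ, toReal z ⬝ᵥ toReal g = D * ∑ j, (L g j : ℝ) * (q j : ℝ) := by
    intro g
    rw [← hp, dotProduct, dotProduct, Finset.mul_sum]
    refine Finset.sum_congr rfl fun i _ => ?_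
    rw [show toReal z i = D * (p i : ℝ) from hz i]
    ring
  have hD' : (0 : ℝ) < D := by exact_mod_cast hD
  refine ⟨z, fun g hg => ?_⟩
  rw [hzg]
  rcases (hm g hg).eq_or_lt with h | h
  · have h0 : ∑ j, L g j • b j = 0 := by
      apply Subtype.ext
      simp only [Submodule.coe_sum, Submodule.coe_smul, Submodule.coe_zero]
      rw [h, hmL]
      exact Finset.sum_congr rfl fun j _ => Rat.smul_def _ _
    have h1 := Fintype.linearIndependent_iff.1 b.linearIndependent _ h0
    simp [h1, ← h]
  · have h1 := hq g hg h
    exact ⟨(mul_pos hD' h1).le, iff_of_false (mul_pos hD' h1).ne' h.ne'⟩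

/-- Linear functionals are nonnegative on a cone as soon as they are so on generators. -/
lemma nonneg_of_generators {S : Set (ι → ℝ)} {m : ι → ℝ} (h : ∀ g ∈ S, 0 ≤ m ⬝ᵥ g) :
    ∀ u ∈ PointedCone.hull ℝ S, 0 ≤ m ⬝ᵥ u := by
  intro u hu
  induction hu using Submodule.span_induction with
  | mem x hx => exact h x hx
  | zero => simp
  | add x y _ _ hx hy => rw [dotProduct_add]; exact add_nonneg hx hy
  | smul a x _ hx =>
    rw [show a • x = (a : ℝ) • x from rfl, dotProduct_smul]
    exact mul_nonneg a.2 hx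

lemma exists_face_integral {τ σ : PointedCone ℝ (ι → ℝ)} (hσ : IsRationalPolyhedral σ)
    (h : IsFace τ σ) : ∃ m ∈ dualMonoid σ, ∀ u, u ∈ τ ↔ u ∈ σ ∧ toReal m ⬝ᵥ u = 0 := by
  obtain ⟨S, rfl⟩ := hσ
  obtain ⟨m, hm, hτ⟩ := h
  obtain ⟨m', hm'⟩ := exists_integral S m fun g hg =>
    hm _ (Submodule.subset_span ⟨g, hg, rfl⟩)
  have hnn : ∀ u ∈ PointedCone.hull ℝ (toReal '' (S : Set (ι → ℤ))), 0 ≤ toReal m' ⬝ᵥ u := by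
    apply nonneg_of_generators
    rintro _ ⟨g, hg, rfl⟩
    exact (hm' g hg).1
  refine ⟨m', hnn, fun u => (hτ u).trans (and_congr_right fun hu => ?_)⟩
  induction hu using Submodule.span_induction with
  | mem x hx =>
    obtain ⟨g, hg, rfl⟩ := hx
    exact (hm' g hg).2.symm
  | zero => simp
  | add x y hx hy ihx ihy =>
    rw [dotProduct_add, dotProduct_add, add_eq_zero_iff_of_nonneg (hm x hx) (hm y hy),
      add_eq_zero_iff_of_nonneg (hnn x hx) (hnn y hy), ihx, ihy]
  | smul a x _ hx =>
    rw [show a • x = (a : ℝ) • x from rfl, dotProduct_smul, dotProduct_smul, smul_eq_zero,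
      smul_eq_zero, hx]

lemma exists_add_nsmul_mem {τ σ : PointedCone ℝ (ι → ℝ)} (hσ : IsRationalPolyhedral σ)
    {m : ι → ℤ} (hm : m ∈ dualMonoid σ) (h : ∀ u, u ∈ τ ↔ u ∈ σ ∧ toReal m ⬝ᵥ u = 0)
    {w : ι → ℤ} (hw : w ∈ dualMonoid τ) : ∃ k : ℕ, w + k • m ∈ dualMonoid σ := by
  obtain ⟨S, rfl⟩ := hσ
  have hcast : ∀ a g : ι → ℤ, toReal a ⬝ᵥ toReal g = ((a ⬝ᵥ g : ℤ) : ℝ) := by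
    intro a g
    simp [dotProduct, toReal]
  refine ⟨∑ g ∈ S, (w ⬝ᵥ g).natAbs, nonneg_of_generators ?_⟩
  rintro _ ⟨g, hg, rfl⟩
  have hgσ : toReal g ∈ PointedCone.hull ℝ (toReal '' (S : Set (ι → ℤ))) :=
    Submodule.subset_span ⟨g, hg, rfl⟩
  have hmg := hm _ hgσ
  have hwg : m ⬝ᵥ g = 0 → 0 ≤ w ⬝ᵥ g := by
    intro h0
    have := hw _ ((h _).2 ⟨hgσ, by rw [hcast, h0, Int.cast_zero]⟩)
    rw [hcast] at this
    exact_mod_cast this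
  rw [hcast] at hmg ⊢
  have hmg' : 0 ≤ m ⬝ᵥ g := by exact_mod_cast hmg
  have hk : (w ⬝ᵥ g).natAbs ≤ ∑ g ∈ S, (w ⬝ᵥ g).natAbs :=
    Finset.single_le_sum (f := fun g => (w ⬝ᵥ g).natAbs) (fun _ _ => Nat.zero_le _) hg
  generalize (∑ g ∈ S, (w ⬝ᵥ g).natAbs) = k at hk
  rw [add_dotProduct, smul_dotProduct, nsmul_eq_mul]
  norm_cast
  rcases hmg'.eq_or_lt with h0 | h0
  · rw [← h0]
    simpa using hwg h0.symm
  · have h1 : (k : ℤ) * 1 ≤ (k : ℤ) * (m ⬝ᵥ g) :=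
      mul_le_mul_of_nonneg_left (by omega) (by omega)
    omega

lemma isLocalization_dualMap {τ σ : PointedCone ℝ (ι → ℝ)} (hσ : IsRationalPolyhedral σ)
    (hle : τ ≤ σ) {m : ι → ℤ} (hm : m ∈ dualMonoid σ)
    (h : ∀ u, u ∈ τ ↔ u ∈ σ ∧ toReal m ⬝ᵥ u = 0) :
    letI := (dualMap hle).toAlgebra
    IsLocalization.Away (AddMonoidAlgebra.single (⟨m, hm⟩ : dualMonoid σ) (1 : ℂ))
      (AddMonoidAlgebra ℂ (dualMonoid τ)) := by
  let _ := (dualMap hle).toAlgebra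
  have hmap : ∀ x, algebraMap (AddMonoidAlgebra ℂ (dualMonoid σ))
      (AddMonoidAlgebra ℂ (dualMonoid τ)) x = dualMap hle x := fun _ => rfl
  have hsingle : ∀ (a : dualMonoid σ) (c : ℂ), dualMap hle (AddMonoidAlgebra.single a c) =
      AddMonoidAlgebra.single (AddSubmonoid.inclusion (dualMonoid_anti hle) a) c := by
    intro a c
    simp [dualMap]
  have hinj : Function.Injective (dualMap hle) :=
    AddMonoidAlgebra.mapDomain_injective (AddSubmonoid.inclusion_injective _)
  have hneg : -m ∈ dualMonoid τ := by
    intro u hu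
    have h1 : toReal (-m) = -toReal m := by ext; simp [toReal]
    rw [h1, neg_dotProduct, ((h u).1 hu).2, neg_zero]
  have hpow : ∀ k : ℕ, (AddMonoidAlgebra.single (⟨m, hm⟩ : dualMonoid σ) (1 : ℂ)) ^ k =
      AddMonoidAlgebra.single (k • (⟨m, hm⟩ : dualMonoid σ)) (1 : ℂ) := by
    intro k
    rw [AddMonoidAlgebra.single_pow, one_pow]
  have hsurj : ∀ z : AddMonoidAlgebra ℂ (dualMonoid τ), ∃ (k : ℕ) (x : _),
      z * dualMap hle ((AddMonoidAlgebra.single (⟨m, hm⟩ : dualMonoid σ) (1 : ℂ)) ^ k) =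
        dualMap hle x := by
    intro z
    induction z using AddMonoidAlgebra.induction_linear with
    | zero => exact ⟨0, 0, by simp⟩
    | add a b ha hb =>
      obtain ⟨k, x, hx⟩ := ha
      obtain ⟨l, y, hy⟩ := hb
      refine ⟨k + l, x * (AddMonoidAlgebra.single (⟨m, hm⟩ : dualMonoid σ) (1 : ℂ)) ^ l +
        y * (AddMonoidAlgebra.single (⟨m, hm⟩ : dualMonoid σ) (1 : ℂ)) ^ k, ?_⟩
      rw [map_add, map_mul, map_mul, ← hx, ← hy, pow_add, map_mul]
      ring
    | single a c =>
      obtain ⟨k, hk⟩ := exists_add_nsmul_mem hσ hm h a.2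
      refine ⟨k, AddMonoidAlgebra.single ⟨_, hk⟩ c, ?_⟩
      rw [hpow, hsingle, hsingle, AddMonoidAlgebra.single_mul_single, mul_one]
      congr 1
  refine IsLocalization.Away.mk _ ?_ ?_ ?_
  · refine IsUnit.of_mul_eq_one (AddMonoidAlgebra.single (⟨-m, hneg⟩ : dualMonoid τ) (1 : ℂ)) ?_
    rw [hmap, hsingle, AddMonoidAlgebra.single_mul_single, mul_one, AddMonoidAlgebra.one_def]
    congr 1
    exact Subtype.ext (add_neg_cancel m)
  · intro z
    obtain ⟨k, x, hx⟩ := hsurj z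
    exact ⟨k, x, by rw [hmap, hmap, ← map_pow, hx]⟩
  · intro a b hab
    rw [hmap, hmap] at hab
    exact ⟨0, by rw [hinj hab]⟩

/-- In a fan, an inclusion of cones is the inclusion of a face, cut out by a lattice vector. -/
lemma Fan.exists_face (F : Fan ι) {τ σ : F.cones} (hle : τ ≤ σ) :
    ∃ m ∈ dualMonoid σ.1, ∀ u, u ∈ τ.1 ↔ u ∈ σ.1 ∧ toReal m ⬝ᵥ u = 0 := by
  have h := (F.isFan.inter_face σ.1 σ.2 τ.1 τ.2).1
  rw [inf_eq_right.2 hle] at h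
  exact exists_face_integral (F.isFan.rational σ.1 σ.2) h

instance Fan.isOpenImmersion (F : Fan ι) {τ σ : F.cones} (f : τ ⟶ σ) :
    IsOpenImmersion ((gluingDiagram F.cones).map f) := by
  obtain ⟨m, hm, h⟩ := F.exists_face (leOfHom f)
  let _ := (dualMap (leOfHom f)).toAlgebra
  have := isLocalization_dualMap (F.isFan.rational σ.1 σ.2) (leOfHom f) hm h
  exact IsOpenImmersion.of_isLocalization
    (AddMonoidAlgebra.single (⟨m, hm⟩ : dualMonoid σ.1) (1 : ℂ))

lemma mem_range_map_iff (F : Fan ι) {τ σ : F.cones} (f : τ ⟶ σ) {m : ι → ℤ}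
    (hm : m ∈ dualMonoid σ.1) (h : ∀ u, u ∈ τ.1 ↔ u ∈ σ.1 ∧ toReal m ⬝ᵥ u = 0)
    (x : (gluingDiagram F.cones).obj σ) :
    (∃ y, (gluingDiagram F.cones).map f y = x) ↔
      AddMonoidAlgebra.single (⟨m, hm⟩ : dualMonoid σ.1) (1 : ℂ) ∉
        PrimeSpectrum.asIdeal (R := AddMonoidAlgebra ℂ (dualMonoid σ.1)) x := by
  let _ := (dualMap (leOfHom f)).toAlgebra
  have := isLocalization_dualMap (F.isFan.rational σ.1 σ.2) (leOfHom f) hm h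
  have hr := PrimeSpectrum.localization_away_comap_range (AddMonoidAlgebra ℂ (dualMonoid τ.1))
    (AddMonoidAlgebra.single (⟨m, hm⟩ : dualMonoid σ.1) (1 : ℂ))
  exact Set.ext_iff.1 hr x

instance Fan.isLocallyDirected (F : Fan ι) :
    (gluingDiagram F.cones ⋙ Scheme.forget).IsLocallyDirected where
  cond := by
    intro i j k fi fj xi xj hx
    obtain ⟨a, ha, hia⟩ := F.exists_face (leOfHom fi)
    obtain ⟨b, hb, hjb⟩ := F.exists_face (leOfHom fj)
    let l : F.cones := ⟨i.1 ⊓ j.1,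
      F.isFan.face_mem i.1 i.2 _ (F.isFan.inter_face i.1 i.2 j.1 j.2).1⟩
    let gi : l ⟶ i := homOfLE (inf_le_left : i.1 ⊓ j.1 ≤ i.1)
    let gj : l ⟶ j := homOfLE (inf_le_right : i.1 ⊓ j.1 ≤ j.1)
    have hl : ∀ u, u ∈ l.1 ↔ u ∈ k.1 ∧ toReal (a + b) ⬝ᵥ u = 0 := by
      intro u
      have hab : toReal (a + b) = toReal a + toReal b := by ext; simp [toReal]
      change u ∈ i.1 ∧ u ∈ j.1 ↔ _
      rw [hia, hjb, hab, add_dotProduct]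
      constructor
      · rintro ⟨⟨h1, h2⟩, _, h3⟩
        exact ⟨h1, by rw [h2, h3, add_zero]⟩
      · rintro ⟨h1, h2⟩
        have h3 := (add_eq_zero_iff_of_nonneg (ha u h1) (hb u h1)).1 h2
        exact ⟨⟨h1, h3.1⟩, h1, h3.2⟩
    have hx' : (gluingDiagram F.cones).map fi xi = (gluingDiagram F.cones).map fj xj := hx
    have h1 := (mem_range_map_iff F fi ha hia _).1 ⟨xi, rfl⟩
    have h2 := (mem_range_map_iff F fj hb hjb _).1 ⟨xj, rfl⟩
    rw [← hx'] at h2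
    obtain ⟨y, hy⟩ := (mem_range_map_iff F (gi ≫ fi) (add_mem ha hb) hl
      ((gluingDiagram F.cones).map fi xi)).2 (by
        intro hmem
        have hmul : AddMonoidAlgebra.single (⟨a + b, add_mem ha hb⟩ : dualMonoid k.1) (1 : ℂ) =
            AddMonoidAlgebra.single (⟨a, ha⟩ : dualMonoid k.1) (1 : ℂ) *
              AddMonoidAlgebra.single (⟨b, hb⟩ : dualMonoid k.1) (1 : ℂ) := by
          rw [AddMonoidAlgebra.single_mul_single, mul_one]
          rfl
        rw [hmul] at hmem
        exact (Ideal.IsPrime.mem_or_mem (PrimeSpectrum.isPrime _) hmem).elim h1 h2)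
    refine ⟨l, gi, gj, y, ?_, ?_⟩
    · apply ((gluingDiagram F.cones).map fi).isOpenEmbedding.injective
      rw [← hy, Functor.map_comp]
      rfl
    · apply ((gluingDiagram F.cones).map fj).isOpenEmbedding.injective
      rw [← hx', ← hy, Subsingleton.elim (gi ≫ fi) (gj ≫ fj), Functor.map_comp]
      rfl

/-- The toric variety `X(Σ)` of a fan `Σ`: the scheme obtained by gluing the affine toric varieties
`U_σ = Spec ℂ[σ^∨ ∩ M]`, `σ ∈ Σ`, along the open subschemes `U_{σ ∩ τ}`. -/
def Fan.toricVariety (F : Fan ι) : Scheme.{0} := colimit (gluingDiagram F.cones)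

/-- The inclusion of the affine chart `U_σ` into `X(Σ)`. -/
def Fan.chart (F : Fan ι) (σ : F.cones) : affineToric σ.1 ⟶ F.toricVariety :=
  colimit.ι (gluingDiagram F.cones) σ

/-- The structure morphism `X(Σ) ⟶ Spec ℂ`. -/
def Fan.structureMorphism (F : Fan ι) : F.toricVariety ⟶ Spec (CommRingCat.of ℂ) :=
  colimit.desc (gluingDiagram F.cones)
    { pt := Spec (CommRingCat.of ℂ)
      ι :=
        { app := fun σ =>
            Spec.map (CommRingCat.ofHom (algebraMap ℂ (AddMonoidAlgebra ℂ (dualMonoid σ.1))))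
          naturality := by
            intro τ σ f
            simp only [gluingDiagram, Functor.const_obj_obj, Functor.const_obj_map,
              Category.comp_id]
            rw [← Spec.map_comp, ← CommRingCat.ofHom_comp, dualMap,
              AddMonoidAlgebra.mapDomainRingHom_comp_algebraMap] } }

/-- The algebraic torus `T = Spec ℂ[M]`. -/
abbrev torus (ι : Type) : Scheme.{0} :=
  Spec (CommRingCat.of (AddMonoidAlgebra ℂ (ι → ℤ)))

/-- The inclusion of the torus `T = Spec ℂ[M]` into `X(Σ)` through the chart `U_σ`. -/
def Fan.torusInclusion (F : Fan ι) (σ : F.cones) : torus ι ⟶ F.toricVariety :=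
  Spec.map (CommRingCat.ofHom
    (AddMonoidAlgebra.mapDomainRingHom ℂ (dualMonoid σ.1).subtype)) ≫ F.chart σ

end ToricVariety

/-! ### The fan `Δ^{(n)}` and the polyhedron `P̃^{(n)}`

Throughout `r = n - 1`, so that `N̄ = M̄ = ℤ^r`, the symmetric group `𝔖_n` is `Perm (Fin (r + 1))`,
and `N = ℤ ⊕ N̄ ⊕ ℤ`, `M = ℤ ⊕ M̄ ⊕ ℤ`. -/

section Permutahedron

/-- The coordinates of `ℤ ⊕ ℤ^r ⊕ ℤ`. -/
abbrev Idx (r : ℕ) : Type := Unit ⊕ Fin r ⊕ Unit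

/-- The vector `(a, w, c)` of `R ⊕ R^r ⊕ R`. -/
abbrev vec {R : Type*} {r : ℕ} (a : R) (w : Fin r → R) (c : R) : Idx r → R :=
  Sum.elim (fun _ => a) (Sum.elim w fun _ => c)

/-- The entries `w_1, …, w_{n-1}` of the middle part of `x`, extended by `w_n = 0`. -/
def middle {R : Type*} [Zero R] {r : ℕ} (x : Idx r → R) : Fin (r + 1) → R :=
  Fin.snoc (α := fun _ => R) (fun i => x (Sum.inr (Sum.inl i))) 0

@[simp] lemma middle_castSucc {R : Type*} [Zero R] {r : ℕ} (x : Idx r → R) (i : Fin r) :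
    middle x i.castSucc = x (Sum.inr (Sum.inl i)) := by simp [middle]

@[simp] lemma middle_last {R : Type*} [Zero R] {r : ℕ} (x : Idx r → R) :
    middle x (Fin.last r) = 0 := by simp [middle]

lemma middle_add {R : Type*} [AddCommGroup R] {r : ℕ} (x y : Idx r → R) (k : Fin (r + 1)) :
    middle (x + y) k = middle x k + middle y k := by
  refine Fin.lastCases ?_ (fun i => ?_) k <;> simp

lemma middle_smul {R : Type*} [CommRing R] {r : ℕ} (c : R) (x : Idx r → R) (k : Fin (r + 1)) :
    middle (c • x) k = c * middle x k := by
  refine Fin.lastCases ?_ (fun i => ?_) k <;> simp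

/-- The action of `𝔖_n` on `R ⊕ R^{n-1} ⊕ R`: with `w_n = 0` and `d = w_{s⁻¹(n)}`, the permutation
`s` sends `(a, w, c)` to `(a - d, (w_{s⁻¹(i)} - d)_i, c + d)`. By `symAction_swap` and
`symAction_swap_last` below, it is the action in which the simple transpositions `(k k+1)`,
`k ≤ n - 2`, interchange the coordinates `w_k` and `w_{k+1}`, and `(n-1 n)` sends `(a, w, c)` to
`(a - w_{n-1}, (w_1 - w_{n-1}, …, w_{n-2} - w_{n-1}, -w_{n-1}), c + w_{n-1})`. -/
def symAction (R : Type*) [CommRing R] (r : ℕ) :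
    Representation R (Equiv.Perm (Fin (r + 1))) (Idx r → R) where
  toFun s :=
    { toFun := fun x =>
        vec (x (Sum.inl ()) - middle x (s⁻¹ (Fin.last r)))
          (fun i => middle x (s⁻¹ i.castSucc) - middle x (s⁻¹ (Fin.last r)))
          (x (Sum.inr (Sum.inr ())) + middle x (s⁻¹ (Fin.last r)))
      map_add' := by
        intro x y
        ext (_ | i | _) <;> simp [middle_add] <;> ring
      map_smul' := by
        intro c x
        ext (_ | i | _) <;> simp [middle_smul] <;> ring }
  map_one' := by
    refine LinearMap.ext fun x => ?_
    ext (_ | i | _) <;> simp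
  map_mul' := by
    intro s t
    refine LinearMap.ext fun x => ?_
    have h : ∀ (a c : R) (k : Fin (r + 1)), middle (vec a
        (fun i => middle x (t⁻¹ i.castSucc) - middle x (t⁻¹ (Fin.last r))) c) k =
          middle x (t⁻¹ k) - middle x (t⁻¹ (Fin.last r)) := by
      intro a c k
      refine Fin.lastCases ?_ (fun i => ?_) k
      · rw [middle_last, sub_self]
      · rw [middle_castSucc]; rfl
    ext (_ | i | _) <;>
      simp only [LinearMap.coe_mk, AddHom.coe_mk, Module.End.mul_apply, Sum.elim_inl, Sum.elim_inr,
        mul_inv_rev, Equiv.Perm.mul_apply, h] <;> ring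

lemma symAction_swap (R : Type*) [CommRing R] (r : ℕ) (i j : Fin r) (x : Idx r → R) :
    symAction R r (Equiv.swap i.castSucc j.castSucc) x =
      x ∘ Equiv.swap (Sum.inr (Sum.inl i)) (Sum.inr (Sum.inl j)) := by
  have hlast : (Equiv.swap i.castSucc j.castSucc) (Fin.last r) = Fin.last r :=
    Equiv.swap_apply_of_ne_of_ne (Fin.castSucc_lt_last i).ne' (Fin.castSucc_lt_last j).ne'
  ext (_ | k | _)
  · simp [symAction, hlast, Equiv.swap_apply_of_ne_of_ne]
  · simp only [symAction, MonoidHom.coe_mk, OneHom.coe_mk, LinearMap.coe_mk, AddHom.coe_mk,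
      Equiv.swap_inv, hlast, middle_last, sub_zero, Sum.elim_inr, Sum.elim_inl,
      Function.comp_apply]
    rcases eq_or_ne k i with rfl | hi
    · simp
    rcases eq_or_ne k j with rfl | hj
    · simp
    rw [Equiv.swap_apply_of_ne_of_ne (by simpa using hi) (by simpa using hj),
      Equiv.swap_apply_of_ne_of_ne (by simpa using hi) (by simpa using hj), middle_castSucc]
  · simp [symAction, hlast, Equiv.swap_apply_of_ne_of_ne]

lemma symAction_swap_last (R : Type*) [CommRing R] (q : ℕ) (x : Idx (q + 1) → R) :
    symAction R (q + 1) (Equiv.swap (Fin.last q).castSucc (Fin.last (q + 1))) x =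
      vec (x (Sum.inl ()) - x (Sum.inr (Sum.inl (Fin.last q))))
        (fun i => if i = Fin.last q then -x (Sum.inr (Sum.inl (Fin.last q)))
          else x (Sum.inr (Sum.inl i)) - x (Sum.inr (Sum.inl (Fin.last q))))
        (x (Sum.inr (Sum.inr ())) + x (Sum.inr (Sum.inl (Fin.last q)))) := by
  ext (_ | k | _)
  · simp [symAction]
  · simp only [symAction, MonoidHom.coe_mk, OneHom.coe_mk, LinearMap.coe_mk, AddHom.coe_mk,
      Equiv.swap_inv, Equiv.swap_apply_right, middle_castSucc, Sum.elim_inr, Sum.elim_inl]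
    rcases eq_or_ne k (Fin.last q) with rfl | hk
    · simp
    rw [Equiv.swap_apply_of_ne_of_ne (by simpa using hk) (Fin.castSucc_lt_last k).ne,
      middle_castSucc, if_neg hk]
  · simp [symAction]

/-- The cone `δ^{(n)}`, generated by the vectors `(1, e_1 + ⋯ + e_j, 0)` for `0 ≤ j ≤ n - 1` and
the vector `(0, 0, 1)`. -/
def delta (r : ℕ) : PointedCone ℝ (Idx r → ℝ) :=
  PointedCone.hull ℝ
    (Set.range (fun j : Fin (r + 1) =>
        vec (1 : ℝ) (fun i : Fin r => if (i : ℕ) < (j : ℕ) then 1 else 0) 0) ∪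
      {vec (0 : ℝ) (fun _ : Fin r => 0) 1})

/-- The translate `s δ^{(n)}`. -/
def deltaTranslate (r : ℕ) (s : Equiv.Perm (Fin (r + 1))) : PointedCone ℝ (Idx r → ℝ) :=
  PointedCone.map (symAction ℝ r s) (delta r)

/-- The fan `Δ^{(n)}`: all faces of the cones `s δ^{(n)}`, `s ∈ 𝔖_n`. -/
def DeltaFan (r : ℕ) : Set (PointedCone ℝ (Idx r → ℝ)) :=
  {τ | ∃ s : Equiv.Perm (Fin (r + 1)), IsFace τ (deltaTranslate r s)}

/-- The support `σ^{(n)}` of `Δ^{(n)}`: the union of the maximal cones `s δ^{(n)}`. -/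
def sigmaCone (r : ℕ) : Set (Idx r → ℝ) :=
  ⋃ s : Equiv.Perm (Fin (r + 1)), (deltaTranslate r s : Set (Idx r → ℝ))

/-- The dual cone `σ^{(n)∨}` in `M_ℝ`. -/
def sigmaDual (r : ℕ) : Set (Idx r → ℝ) :=
  {m | ∀ u ∈ sigmaCone r, 0 ≤ m ⬝ᵥ u}

/-- The permutahedron `P^{(n)}` in `ℝ^{n-1}`: the convex hull of the points
`v_s = (s(1), …, s(n-1)) - (1, …, n-1)`, `s ∈ 𝔖_n`. -/
def permutahedron (r : ℕ) : Set (Fin r → ℝ) :=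
  convexHull ℝ (Set.range fun s : Equiv.Perm (Fin (r + 1)) =>
    fun i : Fin r => ((s i.castSucc : ℕ) : ℝ) - ((i : ℕ) : ℝ))

/-- The polyhedron `P̃^{(n)} = σ^{(n)∨} + ι P^{(n)}`, where `ι` is the inclusion of `M̄_ℝ` as the
middle summand of `M_ℝ = ℝ ⊕ M̄_ℝ ⊕ ℝ`. -/
def tildeP (r : ℕ) : Set (Idx r → ℝ) :=
  sigmaDual r + (fun w : Fin r → ℝ => vec (0 : ℝ) w 0) '' permutahedron r

end Permutahedron

end Toric

end

/-! The cone `s δ` is the region `a ≥ w_{s(1)} ≥ … ≥ w_{s(n)} ≥ -c` with `w_n = 0`. It is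
simplicial: its generators `ray s` and its inner facet normals `facetNormal s` are dual bases
(`facetNormal_dotProduct_ray`), so its faces correspond to subsets of the generators.

The normal cone of the polyhedron at `vertex s` is exactly `s δ`. If `u ∈ s δ`, the rearrangement
inequality shows that `vertex s` minimizes `u` on the permutahedron, and adding elements of the dual
cone cannot lower the value (`vertex_dotProduct_le`). Conversely, `vertex s` plus any facet normal
stays in the polyhedron (`vertex_add_facetNormal_mem`): a normal `w_{s(i)} - w_{s(i+1)}` leads to a
neighbouring vertex, and the normals `a - w_{s(1)}` and `c + w_{s(n)}` lie in the dual cone. So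
minimality at `vertex s` forces all facet inequalities.

A functional bounded below on the polyhedron is nonnegative on the dual cone, and sorting its
entries places it in some `s δ`. Hence each nonempty face contains some `vertex s`, its normal cone
is a face of `s δ`, and every face of `s δ` arises. Intersections of cones are easiest to treat as
normal cones (`isFace_normalCone_inf`), which gives the fan axioms. The varieties are then glued
from the same fan. -/

namespace Toric

/-! ### Faces of finitely generated cones, and normal cones -/

section Cones

variable {ι κ : Type} [Fintype ι]

/-- A subset of a finitely generated cone cut out by functionals which are nonnegative on the cone
is a face. -/
lemma isFace_of_forall [Finite κ] {g : κ → ι → ℝ} {τ : PointedCone ℝ (ι → ℝ)} {L : Set (ι → ℝ)}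
    (hL : ∀ m ∈ L, ∀ k, 0 ≤ m ⬝ᵥ g k)
    (hτ : ∀ u, u ∈ τ ↔ u ∈ PointedCone.hull ℝ (Set.range g) ∧ ∀ m ∈ L, m ⬝ᵥ u = 0) :
    IsFace τ (PointedCone.hull ℝ (Set.range g)) := by
  classical
  have := Fintype.ofFinite κ
  have hL' : ∀ m ∈ L, ∀ u ∈ PointedCone.hull ℝ (Set.range g), 0 ≤ m ⬝ᵥ u := fun m hm =>
    nonneg_of_generators (by rintro _ ⟨k, rfl⟩; exact hL m hm k)
  -- `L` may be infinite, but finitely many functionals suffice: for each generator take one in `L`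
  -- not vanishing there, or `0` if there is none. Their sum cuts out the face.
  have hq : ∀ k, ∃ q ∈ insert 0 L, q ⬝ᵥ g k = 0 → ∀ m ∈ L, m ⬝ᵥ g k = 0 := by
    intro k
    by_cases h : ∀ m ∈ L, m ⬝ᵥ g k = 0
    · exact ⟨0, Set.mem_insert _ _, fun _ => h⟩
    · push Not at h
      obtain ⟨m, hm, hk⟩ := h
      exact ⟨m, Set.mem_insert_of_mem _ hm, fun h0 => absurd h0 hk⟩
  choose q hqL hq using hq
  have hq0 : ∀ k, ∀ u ∈ PointedCone.hull ℝ (Set.range g), 0 ≤ q k ⬝ᵥ u := by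
    intro k u hu
    rcases hqL k with h | h
    · simp [h]
    · exact hL' _ h u hu
  have hnn : ∀ u ∈ PointedCone.hull ℝ (Set.range g), 0 ≤ (∑ k, q k) ⬝ᵥ u := by
    intro u hu
    rw [sum_dotProduct]
    exact Finset.sum_nonneg fun k _ => hq0 k u hu
  refine ⟨∑ k, q k, hnn, fun u => (hτ u).trans (and_congr_right fun hu => ⟨fun h => ?_, ?_⟩)⟩
  · rw [sum_dotProduct]
    refine Finset.sum_eq_zero fun k _ => ?_
    rcases hqL k with h' | h'
    · simp [h']
    · exact h _ h'
  induction hu using Submodule.span_induction with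
  | mem x hx =>
    obtain ⟨k, rfl⟩ := hx
    intro h
    rw [sum_dotProduct, Finset.sum_eq_zero_iff_of_nonneg fun j _ =>
      hq0 j _ (Submodule.subset_span ⟨k, rfl⟩)] at h
    exact hq k (h k (Finset.mem_univ k))
  | zero => simp
  | add x y hx hy ihx ihy =>
    intro h m hm
    rw [dotProduct_add, add_eq_zero_iff_of_nonneg (hnn x hx) (hnn y hy)] at h
    rw [dotProduct_add, ihx h.1 m hm, ihy h.2 m hm, add_zero]
  | smul a x _ ih =>
    intro h m hm
    rw [show a • x = (a : ℝ) • x from rfl, dotProduct_smul, smul_eq_zero] at h ⊢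
    exact h.imp_right fun h => ih h m hm

/-- A face of a cone is generated by the generators of the cone which it contains. -/
lemma IsFace.exists_generators {g : κ → ι → ℝ} {J : Set κ} {τ : PointedCone ℝ (ι → ℝ)}
    (h : IsFace τ (PointedCone.hull ℝ (g '' J))) :
    ∃ J' ⊆ J, τ = PointedCone.hull ℝ (g '' J') := by
  obtain ⟨m, hm, hτ⟩ := h
  refine ⟨{k ∈ J | m ⬝ᵥ g k = 0}, fun k hk => hk.1, le_antisymm ?_ ?_⟩
  · intro u hu
    obtain ⟨hu, h0⟩ := (hτ u).1 hu
    induction hu using Submodule.span_induction with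
    | mem x hx =>
      obtain ⟨k, hk, rfl⟩ := hx
      exact Submodule.subset_span ⟨k, ⟨hk, h0⟩, rfl⟩
    | zero => exact zero_mem _
    | add x y hx hy ihx ihy =>
      rw [dotProduct_add, add_eq_zero_iff_of_nonneg (hm x hx) (hm y hy)] at h0
      exact add_mem (ihx ((hτ x).2 ⟨hx, h0.1⟩) h0.1) (ihy ((hτ y).2 ⟨hy, h0.2⟩) h0.2)
    | smul a x hx ih =>
      rw [show a • x = (a : ℝ) • x from rfl, dotProduct_smul, smul_eq_zero] at h0
      rcases h0 with h0 | h0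
      · rw [show a = 0 from Subtype.ext h0, zero_smul]
        exact zero_mem _
      · exact Submodule.smul_mem _ _ (ih ((hτ x).2 ⟨hx, h0⟩) h0)
  · refine Submodule.span_le.2 ?_
    rintro _ ⟨k, ⟨hk, h0⟩, rfl⟩
    exact (hτ _).2 ⟨Submodule.subset_span ⟨k, hk, rfl⟩, h0⟩

/-- The intersection of two finitely generated normal cones is a face of the first. -/
lemma isFace_normalCone_inf [Finite κ] {g : κ → ι → ℝ} {P Q R : Set (ι → ℝ)}
    (hQ : Q.Nonempty) (hQP : Q ⊆ P) (hRP : R ⊆ P)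
    (hg : normalCone P Q = PointedCone.hull ℝ (Set.range g)) :
    IsFace (normalCone P Q ⊓ normalCone P R) (normalCone P Q) := by
  obtain ⟨p, hp⟩ := hQ
  have key : ∀ q ∈ P, ∀ u ∈ normalCone P Q, 0 ≤ (q - p) ⬝ᵥ u := fun q hq u hu => by
    rw [sub_dotProduct]
    exact sub_nonneg.2 (hu p hp q hq)
  rw [hg]
  -- On the normal cone of `Q`, the point `p ∈ Q` is already a minimum, so `u` is also minimal on
  -- `R` exactly when every `q ∈ R` takes the same value as `p`.
  refine isFace_of_forall (L := (fun q => q - p) '' R) ?_ ?_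
  · rintro _ ⟨q, hq, rfl⟩ k
    exact key q (hRP hq) _ (hg ▸ Submodule.subset_span ⟨k, rfl⟩)
  · intro u
    rw [← hg, Submodule.mem_inf, Set.forall_mem_image]
    refine and_congr_right fun hu => ⟨fun h q hq => le_antisymm ?_ (key q (hRP hq) u hu), ?_⟩
    · rw [sub_dotProduct]
      exact sub_nonpos.2 (h q hq p (hQP hp))
    · intro h q hq q' hq'
      have := h hq
      rw [sub_dotProduct, sub_eq_zero] at this
      rw [this]
      exact hu p hp q' hq'

/-- The normal fan consists of the normal cones of the nonempty sets of minima of the functionals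
`· ⬝ᵥ x`. -/
lemma mem_normalFan_iff {P : Set (ι → ℝ)} {σ : PointedCone ℝ (ι → ℝ)} :
    σ ∈ normalFan P ↔ ∃ x : ι → ℝ, {q ∈ P | ∀ p ∈ P, q ⬝ᵥ x ≤ p ⬝ᵥ x}.Nonempty ∧
      σ = normalCone P {q ∈ P | ∀ p ∈ P, q ⬝ᵥ x ≤ p ⬝ᵥ x} := by
  classical
  constructor
  · rintro ⟨Q, hne, hQ, rfl⟩
    obtain ⟨l, hl⟩ := hQ hne
    -- Exposed faces are sets of maxima, inner normals describe minima; hence the sign.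
    have key : ∀ y : ι → ℝ, y ⬝ᵥ (fun i => -l (Pi.single i 1)) = -l y := by
      intro y
      conv_rhs => rw [← Finset.univ_sum_single y, map_sum]
      rw [dotProduct, ← Finset.sum_neg_distrib]
      refine Finset.sum_congr rfl fun i _ => ?_
      have : (Pi.single i (y i) : ι → ℝ) = y i • Pi.single i 1 := by
        rw [← Pi.single_smul, smul_eq_mul, mul_one]
      rw [this, map_smul, smul_eq_mul, mul_neg]
    have hQ' : Q = {q ∈ P | ∀ p ∈ P, q ⬝ᵥ (fun i => -l (Pi.single i 1)) ≤
        p ⬝ᵥ (fun i => -l (Pi.single i 1))} := by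
      rw [hl]
      simp only [key, neg_le_neg_iff]
    exact ⟨_, hQ' ▸ hne, by rw [← hQ']⟩
  · rintro ⟨x, hne, rfl⟩
    refine ⟨_, hne, fun _ => ⟨LinearMap.toContinuousLinearMap
      { toFun := fun y => -(y ⬝ᵥ x)
        map_add' := fun y z => by rw [add_dotProduct, neg_add]
        map_smul' := fun c y => by simp }, ?_⟩, rfl⟩
    ext q
    simp

end Cones

/-! ### The torus inside the toric variety -/

section ToricVariety

variable {ι : Type} [Fintype ι]

lemma Fan.torusInclusion_of_le (F : Fan ι) {τ σ : F.cones} (h : τ ≤ σ) :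
    F.torusInclusion τ = F.torusInclusion σ := by
  have hw : F.chart τ = Spec.map (CommRingCat.ofHom (dualMap h)) ≫ F.chart σ :=
    (colimit.w (gluingDiagram F.cones) (homOfLE h)).symm
  rw [torusInclusion, torusInclusion, hw, ← Category.assoc, ← Spec.map_comp,
    ← CommRingCat.ofHom_comp, dualMap, ← AddMonoidAlgebra.mapDomainRingHom_comp]
  rfl

/-- The inclusion of the torus does not depend on the chart. -/
lemma Fan.torusInclusion_eq (F : Fan ι) (σ τ : F.cones) :
    F.torusInclusion σ = F.torusInclusion τ := by
  -- Both charts are compared through the chart of the common face.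
  let l : F.cones := ⟨σ.1 ⊓ τ.1,
    F.isFan.face_mem σ.1 σ.2 _ (F.isFan.inter_face σ.1 σ.2 τ.1 τ.2).1⟩
  rw [← F.torusInclusion_of_le (τ := l) (σ := σ) (inf_le_left : σ.1 ⊓ τ.1 ≤ σ.1),
    ← F.torusInclusion_of_le (τ := l) (σ := τ) (inf_le_right : σ.1 ⊓ τ.1 ≤ τ.1)]

/-- Equal fans have isomorphic toric varieties, compatibly with the torus. -/
lemma exists_toricVariety_iso {C D : Set (PointedCone ℝ (ι → ℝ))} (h : C = D) (hC : IsFan C)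
    (hD : IsFan D) :
    ∃ e : Fan.toricVariety ⟨C, hC⟩ ≅ Fan.toricVariety ⟨D, hD⟩,
      e.hom ≫ Fan.structureMorphism ⟨D, hD⟩ = Fan.structureMorphism ⟨C, hC⟩ ∧
      ∀ (σ : C) (τ : D),
        Fan.torusInclusion ⟨C, hC⟩ σ ≫ e.hom = Fan.torusInclusion ⟨D, hD⟩ τ := by
  subst h
  exact ⟨Iso.refl _, Category.id_comp _, fun σ τ =>
    (Category.comp_id _).trans (Fan.torusInclusion_eq ⟨C, hC⟩ σ τ)⟩

end ToricVariety

end Toric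

namespace Toric

section Permutahedron

variable {r : ℕ}

/-! ### The action and the coordinate functionals -/

lemma symAction_inl (R : Type*) [CommRing R] (s : Equiv.Perm (Fin (r + 1))) (x : Idx r → R) :
    symAction R r s x (Sum.inl ()) = x (Sum.inl ()) - middle x (s⁻¹ (Fin.last r)) := rfl

lemma symAction_inr (R : Type*) [CommRing R] (s : Equiv.Perm (Fin (r + 1))) (x : Idx r → R) :
    symAction R r s x (Sum.inr (Sum.inr ())) =
      x (Sum.inr (Sum.inr ())) + middle x (s⁻¹ (Fin.last r)) := rfl

/-- The action permutes the extended sequence `w_1, …, w_n` and then subtracts a constant to restore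
`w_n = 0`. -/
lemma middle_symAction (R : Type*) [CommRing R] (s : Equiv.Perm (Fin (r + 1))) (x : Idx r → R)
    (k : Fin (r + 1)) :
    middle (symAction R r s x) k = middle x (s⁻¹ k) - middle x (s⁻¹ (Fin.last r)) := by
  refine Fin.lastCases ?_ (fun i => ?_) k
  · rw [middle_last, sub_self]
  · rw [middle_castSucc]; rfl

/-- Shows that the generators of `s δ` are lattice vectors, hence that the cones are rational. -/
lemma toReal_symAction (s : Equiv.Perm (Fin (r + 1))) (x : Idx r → ℤ) :
    toReal (symAction ℤ r s x) = symAction ℝ r s (toReal x) := by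
  have h : ∀ k, middle (toReal x) k = ((middle x k : ℤ) : ℝ) := by
    intro k
    refine Fin.lastCases ?_ (fun i => ?_) k <;> simp [toReal]
  ext (_ | i | _) <;> simp [symAction, h] <;> simp [toReal]

/-- The functional `x ↦ x_k` in the extended middle coordinates. -/
def middleCoord (k : Fin (r + 1)) : Idx r → ℝ := vec 0 (fun i => if i.castSucc = k then 1 else 0) 0

-- For the last index the functional is zero, in agreement with `w_n = 0`.
@[simp] lemma middleCoord_dotProduct (k : Fin (r + 1)) (x : Idx r → ℝ) :
    middleCoord k ⬝ᵥ x = middle x k := by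
  refine Fin.lastCases ?_ (fun i => ?_) k
  · simp [middleCoord, dotProduct, Fintype.sum_sum_type, Fin.castSucc_ne_last]
  · simp [middleCoord, dotProduct, Fintype.sum_sum_type]

/-- The functional `(a, w, c) ↦ a`. -/
def firstCoord (r : ℕ) : Idx r → ℝ := vec 1 0 0

@[simp] lemma firstCoord_dotProduct (x : Idx r → ℝ) : firstCoord r ⬝ᵥ x = x (Sum.inl ()) := by
  simp [firstCoord, dotProduct, Fintype.sum_sum_type]

/-- The functional `(a, w, c) ↦ c`. -/
def lastCoord (r : ℕ) : Idx r → ℝ := vec 0 0 1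

@[simp] lemma lastCoord_dotProduct (x : Idx r → ℝ) :
    lastCoord r ⬝ᵥ x = x (Sum.inr (Sum.inr ())) := by
  simp [lastCoord, dotProduct, Fintype.sum_sum_type]

/-! ### The simplicial cones `s δ` and their dual bases -/

/-- The sequence `a, w_{s(1)}, …, w_{s(n)}`. -/
def chain (s : Equiv.Perm (Fin (r + 1))) (x : Idx r → ℝ) : Fin (r + 2) → ℝ :=
  Fin.cons (x (Sum.inl ())) fun k => middle x (s k)

/-- The primitive inner normals of the facets of `s δ^{(n)}`. -/
def facetNormal (s : Equiv.Perm (Fin (r + 1))) : Fin (r + 1) ⊕ Unit → Idx r → ℝ :=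
  Sum.elim (fun j => (Fin.cons (firstCoord r) fun k => middleCoord (s k) :
    Fin (r + 2) → Idx r → ℝ) j.castSucc - middleCoord (s j))
    fun _ => lastCoord r + middleCoord (s (Fin.last r))

lemma facetNormal_inl_dotProduct (s : Equiv.Perm (Fin (r + 1))) (j : Fin (r + 1))
    (x : Idx r → ℝ) :
    facetNormal s (Sum.inl j) ⬝ᵥ x = chain s x j.castSucc - chain s x j.succ := by
  refine Fin.cases ?_ (fun i => ?_) j
  · simp [facetNormal, chain]
  · rw [← Fin.succ_castSucc]
    simp [facetNormal, chain]

lemma facetNormal_inr_dotProduct (s : Equiv.Perm (Fin (r + 1))) (j : Unit) (x : Idx r → ℝ) :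
    facetNormal s (Sum.inr j) ⬝ᵥ x = x (Sum.inr (Sum.inr ())) + middle x (s (Fin.last r)) := by
  simp [facetNormal]

/-- The generators of `δ^{(n)}`, as lattice vectors. -/
def deltaRay (r : ℕ) : Fin (r + 1) ⊕ Unit → Idx r → ℤ :=
  Sum.elim (fun j => vec 1 (fun i => if (i : ℕ) < (j : ℕ) then 1 else 0) 0) fun _ => vec 0 0 1

/-- The generators of `s δ^{(n)}`. -/
def ray (s : Equiv.Perm (Fin (r + 1))) (k : Fin (r + 1) ⊕ Unit) : Idx r → ℝ :=
  toReal (symAction ℤ r s (deltaRay r k))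

lemma deltaTranslate_eq_hull (s : Equiv.Perm (Fin (r + 1))) :
    deltaTranslate r s = PointedCone.hull ℝ (Set.range (ray s)) := by
  rw [deltaTranslate, delta, PointedCone.map, PointedCone.hull, Submodule.map_span]
  congr 1
  have hr : ∀ k, ray s k = symAction ℝ r s (toReal (deltaRay r k)) := fun k => toReal_symAction _ _
  have h1 : ∀ j : Fin (r + 1), toReal (deltaRay r (Sum.inl j)) =
      vec (1 : ℝ) (fun i : Fin r => if (i : ℕ) < (j : ℕ) then 1 else 0) 0 := by
    intro j
    ext (_ | i | _) <;> simp [toReal, deltaRay]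
  have h2 : ∀ j : Unit, toReal (deltaRay r (Sum.inr j)) =
      vec (0 : ℝ) (fun _ : Fin r => 0) 1 := by
    intro j
    ext (_ | i | _) <;> simp [toReal, deltaRay]
  rw [← Set.image_univ (f := ray s), ← Set.range_inl_union_range_inr, Set.image_union,
    Set.image_union, ← Set.range_comp, ← Set.range_comp, ← Set.range_comp, Set.image_singleton]
  congr 1
  · congr 1
    funext j
    rw [Function.comp_apply, Function.comp_apply, hr, h1]
    rfl
  · ext x
    simp only [Set.mem_singleton_iff, Set.mem_range, Function.comp_apply, hr, h2, exists_const]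
    exact eq_comm

/-- Each generator with first entry `1` is a step sequence, so exactly one of its consecutive
differences is nonzero; this is the source of the duality with the facet normals. -/
lemma chain_one_deltaRay (j : Fin (r + 1)) (p : Fin (r + 2)) :
    chain 1 (toReal (deltaRay r (Sum.inl j))) p = if (p : ℕ) ≤ j then 1 else 0 := by
  refine Fin.cases ?_ (fun k => ?_) p
  · simp [chain, toReal, deltaRay]
  · refine Fin.lastCases ?_ (fun i => ?_) k
    · simp [chain]
      omega
    · simp [chain, toReal, deltaRay]

/-- The action shifts all chain entries by one constant and `c` by its opposite, so differences and
`c + w_{s(n)}` are unaffected. This reduces the duality to `s = 1`. -/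
lemma facetNormal_dotProduct_symAction (s : Equiv.Perm (Fin (r + 1))) (k : Fin (r + 1) ⊕ Unit)
    (x : Idx r → ℝ) : facetNormal s k ⬝ᵥ symAction ℝ r s x = facetNormal 1 k ⬝ᵥ x := by
  have hc : ∀ p, chain s (symAction ℝ r s x) p = chain 1 x p - middle x (s⁻¹ (Fin.last r)) := by
    intro p
    refine Fin.cases ?_ (fun i => ?_) p
    · simp [chain, symAction_inl]
    · simp [chain, middle_symAction]
  rcases k with j | j
  · rw [facetNormal_inl_dotProduct, facetNormal_inl_dotProduct, hc, hc]
    ring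
  · rw [facetNormal_inr_dotProduct, facetNormal_inr_dotProduct, symAction_inr, middle_symAction]
    simp

/-- The generators and the facet normals of `s δ^{(n)}` are dual to each other. -/
lemma facetNormal_dotProduct_ray (s : Equiv.Perm (Fin (r + 1))) (k l : Fin (r + 1) ⊕ Unit) :
    facetNormal s k ⬝ᵥ ray s l = if l = k then 1 else 0 := by
  rw [ray, toReal_symAction, facetNormal_dotProduct_symAction]
  rcases k with j | j <;> rcases l with i | i
  · rw [facetNormal_inl_dotProduct, chain_one_deltaRay, chain_one_deltaRay]
    simp only [Fin.val_castSucc, Fin.val_succ, Sum.inl.injEq, Fin.ext_iff]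
    split_ifs <;> first | omega | simp
  · rw [facetNormal_inl_dotProduct]
    have : ∀ p, chain 1 (toReal (deltaRay r (Sum.inr i))) p = 0 := by
      intro p
      refine Fin.cases ?_ (fun k => ?_) p
      · simp [chain, toReal, deltaRay]
      · refine Fin.lastCases ?_ (fun i => ?_) k
        · simp [chain]
        · simp [chain, toReal, deltaRay]
    simp [this]
  · rw [facetNormal_inr_dotProduct]
    simp [toReal, deltaRay]
  · rw [facetNormal_inr_dotProduct]
    simp [toReal, deltaRay]

lemma eq_zero_of_facetNormal (s : Equiv.Perm (Fin (r + 1))) {x : Idx r → ℝ}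
    (h : ∀ k, facetNormal s k ⬝ᵥ x = 0) : x = 0 := by
  have h1 : ∀ j, chain s x j = chain s x (Fin.last (r + 1)) := by
    intro j
    induction j using Fin.reverseInduction with
    | last => rfl
    | cast i ih =>
      rw [← ih]
      have := h (Sum.inl i)
      rwa [facetNormal_inl_dotProduct, sub_eq_zero] at this
  have h2 : ∀ j, chain s x j = 0 := by
    intro j
    -- The chain is constant, and at this position its entry is `w_n = 0`.
    have := h1 (s⁻¹ (Fin.last r)).succ
    rw [h1 j, ← this]
    simp [chain]
  have hm : ∀ k, middle x k = 0 := by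
    intro k
    simpa [chain] using h2 (s⁻¹ k).succ
  have h3 := h (Sum.inr ())
  rw [facetNormal_inr_dotProduct, hm, add_zero] at h3
  ext (_ | i | _)
  · exact h2 0
  · simpa using hm i.castSucc
  · exact h3

/-- Both sides have the same facet coordinates by duality, and these separate points. -/
lemma sum_facetNormal_smul_ray (s : Equiv.Perm (Fin (r + 1))) (x : Idx r → ℝ) :
    ∑ k, (facetNormal s k ⬝ᵥ x) • ray s k = x := by
  rw [← sub_eq_zero]
  refine eq_zero_of_facetNormal s fun k => ?_
  rw [dotProduct_sub, dotProduct_sum]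
  simp [dotProduct_smul, facetNormal_dotProduct_ray]

/-- The faces of `s δ^{(n)}` are described by the vanishing of facet normals. -/
lemma mem_hull_ray_image (s : Equiv.Perm (Fin (r + 1))) (J : Set (Fin (r + 1) ⊕ Unit))
    (u : Idx r → ℝ) : u ∈ PointedCone.hull ℝ (ray s '' J) ↔
      ∀ k, 0 ≤ facetNormal s k ⬝ᵥ u ∧ (k ∉ J → facetNormal s k ⬝ᵥ u = 0) := by
  constructor
  · intro hu k
    constructor
    · refine nonneg_of_generators ?_ u hu
      rintro _ ⟨l, _, rfl⟩
      rw [facetNormal_dotProduct_ray]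
      split_ifs <;> simp
    · intro hk
      induction hu using Submodule.span_induction with
      | mem x hx =>
        obtain ⟨l, hl, rfl⟩ := hx
        rw [facetNormal_dotProduct_ray, if_neg]
        rintro rfl
        exact hk hl
      | zero => simp
      | add x y _ _ hx hy => rw [dotProduct_add, hx, hy, add_zero]
      | smul a x _ hx => rw [show a • x = (a : ℝ) • x from rfl, dotProduct_smul, hx, smul_zero]
  · intro h
    rw [← sum_facetNormal_smul_ray s u]
    refine sum_mem fun k _ => ?_
    by_cases hk : k ∈ J
    · exact Submodule.smul_mem _ (⟨_, (h k).1⟩ : {c : ℝ // 0 ≤ c})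
        (Submodule.subset_span ⟨k, hk, rfl⟩)
    · rw [(h k).2 hk, zero_smul]
      exact zero_mem _

lemma mem_deltaTranslate (s : Equiv.Perm (Fin (r + 1))) (u : Idx r → ℝ) :
    u ∈ deltaTranslate r s ↔ ∀ k, 0 ≤ facetNormal s k ⬝ᵥ u := by
  rw [deltaTranslate_eq_hull, ← Set.image_univ, mem_hull_ray_image]
  simp

lemma isFace_hull_ray_image (s : Equiv.Perm (Fin (r + 1))) (J : Set (Fin (r + 1) ⊕ Unit)) :
    IsFace (PointedCone.hull ℝ (ray s '' J)) (deltaTranslate r s) := by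
  rw [deltaTranslate_eq_hull]
  refine isFace_of_forall (L := facetNormal s '' Jᶜ) ?_ fun u => ?_
  · rintro _ ⟨k, _, rfl⟩ l
    rw [facetNormal_dotProduct_ray]
    split_ifs <;> simp
  · rw [← deltaTranslate_eq_hull, mem_deltaTranslate, mem_hull_ray_image, forall_and,
      Set.forall_mem_image]
    rfl

/-- The cones of `Δ^{(n)}` are those generated by some of the generators of some `s δ^{(n)}`. -/
lemma mem_DeltaFan_iff {τ : PointedCone ℝ (Idx r → ℝ)} :
    τ ∈ DeltaFan r ↔ ∃ s J, τ = PointedCone.hull ℝ (ray s '' J) := by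
  constructor
  · rintro ⟨s, hs⟩
    rw [deltaTranslate_eq_hull, ← Set.image_univ] at hs
    obtain ⟨J, _, rfl⟩ := hs.exists_generators
    exact ⟨s, J, rfl⟩
  · rintro ⟨s, J, rfl⟩
    exact ⟨s, isFace_hull_ray_image s J⟩

/-! ### The support and its dual cone -/

lemma chain_antitone {s : Equiv.Perm (Fin (r + 1))} {u : Idx r → ℝ}
    (hu : u ∈ deltaTranslate r s) : Antitone (chain s u) := by
  refine Fin.antitone_iff_succ_le.2 fun i => ?_
  have := (mem_deltaTranslate s u).1 hu (Sum.inl i)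
  rwa [facetNormal_inl_dotProduct, sub_nonneg] at this

lemma exists_mem_deltaTranslate {u : Idx r → ℝ} (h1 : ∀ k, middle u k ≤ u (Sum.inl ()))
    (h2 : ∀ k, 0 ≤ u (Sum.inr (Sum.inr ())) + middle u k) : ∃ s, u ∈ deltaTranslate r s := by
  -- Sorting the negatives in increasing order puts the `w_k` in decreasing order.
  refine ⟨Tuple.sort (fun k => -middle u k), (mem_deltaTranslate _ _).2 ?_⟩
  have hs := Tuple.monotone_sort (fun k => -middle u k)
  rintro (j | j)
  · rw [facetNormal_inl_dotProduct, sub_nonneg]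
    refine Fin.cases ?_ (fun i => ?_) j
    · simpa [chain] using h1 _
    · rw [← Fin.succ_castSucc]
      simpa [chain] using hs (Fin.castSucc_le_succ i)
  · rw [facetNormal_inr_dotProduct]
    exact h2 _

lemma firstCoord_sub_mem_sigmaDual (k : Fin (r + 1)) :
    firstCoord r - middleCoord k ∈ sigmaDual r := by
  intro u hu
  obtain ⟨s, hs⟩ := Set.mem_iUnion.1 hu
  have := chain_antitone hs (Fin.zero_le (s⁻¹ k).succ)
  rw [sub_dotProduct, sub_nonneg]
  simpa [chain] using this

/-- On `s δ` the smallest of the `w_k` is `w_{s(n)}`, so the bound for it implies all the others. -/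
lemma lastCoord_add_mem_sigmaDual (k : Fin (r + 1)) :
    lastCoord r + middleCoord k ∈ sigmaDual r := by
  intro u hu
  obtain ⟨s, hs⟩ := Set.mem_iUnion.1 hu
  have h1 := chain_antitone hs (Fin.le_last (s⁻¹ k).succ)
  have h2 := (mem_deltaTranslate s u).1 hs (Sum.inr ())
  rw [facetNormal_inr_dotProduct] at h2
  rw [← Fin.succ_last] at h1
  have hk : s (s⁻¹ k) = k := s.apply_symm_apply k
  simp only [chain, Fin.cons_succ, hk] at h1
  rw [add_dotProduct, lastCoord_dotProduct, middleCoord_dotProduct]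
  linarith

/-- Elements of the dual cone are recession directions of the polyhedron. -/
lemma add_mem_tildeP {m p : Idx r → ℝ} (hm : m ∈ sigmaDual r) (hp : p ∈ tildeP r) :
    p + m ∈ tildeP r := by
  obtain ⟨m', hm', w, hw, rfl⟩ := hp
  refine ⟨m' + m, fun u hu => ?_, w, hw, by simp only; abel⟩
  rw [add_dotProduct]
  exact add_nonneg (hm' u hu) (hm u hu)

/-! ### Vertices and their normal cones -/

/-- The vertex of `P̃^{(n)}` whose normal cone is `s δ^{(n)}`. -/
def vertex (s : Equiv.Perm (Fin (r + 1))) : Idx r → ℝ :=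
  vec 0 (fun i : Fin r => ((s⁻¹ i.castSucc : ℕ) : ℝ) - ((i : ℕ) : ℝ)) 0

lemma vertex_mem_tildeP (s : Equiv.Perm (Fin (r + 1))) : vertex s ∈ tildeP r :=
  ⟨0, fun u _ => by simp, _, ⟨_, subset_convexHull ℝ _ ⟨s⁻¹, rfl⟩, rfl⟩, zero_add _⟩

/-- The sums may run over all `n` indices because `w_n = 0`. The second sum does not depend on `s`,
so comparing vertices only involves the first. -/
lemma vertex_dotProduct (s : Equiv.Perm (Fin (r + 1))) (u : Idx r → ℝ) :
    vertex s ⬝ᵥ u = ∑ k, ((s⁻¹ k : ℕ) : ℝ) * middle u k - ∑ k : Fin (r + 1), (k : ℕ) * middle u k := by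
  rw [← Finset.sum_sub_distrib, Fin.sum_univ_castSucc]
  simp [vertex, dotProduct, Fintype.sum_sum_type, sub_mul]

/-- Rearrangement inequality: after reindexing by `s`, the weights `0, 1, …, r` increase while the
`w_{s(k)}` decrease, which gives the smallest possible sum. -/
lemma vertex_dotProduct_le_vertex {s : Equiv.Perm (Fin (r + 1))} {u : Idx r → ℝ}
    (hu : u ∈ deltaTranslate r s) (t : Equiv.Perm (Fin (r + 1))) :
    vertex s ⬝ᵥ u ≤ vertex t ⬝ᵥ u := by
  rw [vertex_dotProduct, vertex_dotProduct]
  refine sub_le_sub_right ?_ _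
  rw [← Equiv.sum_comp s (fun k => ((s⁻¹ k : ℕ) : ℝ) * middle u k),
    ← Equiv.sum_comp s (fun k => ((t⁻¹ k : ℕ) : ℝ) * middle u k)]
  have hm : Monotone (fun k : Fin (r + 1) => ((k : ℕ) : ℝ)) := fun a b h => by
    exact Nat.cast_le.2 (Fin.le_def.1 h)
  have ha : Antitone (fun k : Fin (r + 1) => middle u (s k)) := fun a b h => by
    simpa [chain] using chain_antitone hu (Fin.succ_le_succ_iff.2 h)
  simpa using (hm.antivary ha).sum_mul_le_sum_comp_perm_mul (σ := t⁻¹ * s)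

lemma vertex_dotProduct_le {s : Equiv.Perm (Fin (r + 1))} {u : Idx r → ℝ}
    (hu : u ∈ deltaTranslate r s) {p : Idx r → ℝ} (hp : p ∈ tildeP r) :
    vertex s ⬝ᵥ u ≤ p ⬝ᵥ u := by
  obtain ⟨m, hm, _, ⟨w, hw, rfl⟩, rfl⟩ := hp
  have hlin : IsLinearMap ℝ fun w : Fin r → ℝ => vec (0 : ℝ) w 0 ⬝ᵥ u :=
    ⟨fun w w' => by simp [dotProduct, Fintype.sum_sum_type, add_mul, Finset.sum_add_distrib],
      fun c w => by simp [dotProduct, Fintype.sum_sum_type, mul_assoc, Finset.mul_sum]⟩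
  have hsub : permutahedron r ⊆ {w | vertex s ⬝ᵥ u ≤ vec (0 : ℝ) w 0 ⬝ᵥ u} := by
    refine convexHull_min ?_ (convex_halfSpace_ge hlin _)
    rintro _ ⟨t, rfl⟩
    have := vertex_dotProduct_le_vertex hu t⁻¹
    rwa [vertex.eq_1 t⁻¹, inv_inv] at this
  simp only [add_dotProduct]
  exact le_add_of_nonneg_of_le (hm u (Set.mem_iUnion.2 ⟨s, hu⟩)) (hsub hw)

/-- Moving from the vertex along a facet normal of its normal cone stays inside `P̃^{(n)}`. -/
lemma vertex_add_facetNormal_mem (s : Equiv.Perm (Fin (r + 1))) (k : Fin (r + 1) ⊕ Unit) :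
    vertex s + facetNormal s k ∈ tildeP r := by
  rcases k with j | j
  · refine Fin.cases ?_ (fun i => ?_) j
    · exact add_mem_tildeP (firstCoord_sub_mem_sigmaDual _) (vertex_mem_tildeP s)
    -- The normal raises the value of `s⁻¹` at `s i.castSucc` by one and lowers it at `s i.succ` by
    -- one. These values are consecutive, so they are exchanged.
    · have : vertex s + facetNormal s (Sum.inl i.succ) =
          vertex (s * Equiv.swap i.castSucc i.succ) := by
        have hf : facetNormal s (Sum.inl i.succ) =
            middleCoord (s i.castSucc) - middleCoord (s i.succ) := by
          simp [facetNormal]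
        rw [hf]
        ext (_ | l | _)
        · simp [vertex, middleCoord]
        · simp only [vertex, middleCoord, Pi.add_apply, Pi.sub_apply, Sum.elim_inr, Sum.elim_inl,
            mul_inv_rev, Equiv.swap_inv, Equiv.Perm.mul_apply, ← Equiv.Perm.inv_eq_iff_eq]
          generalize s⁻¹ l.castSucc = q
          rcases eq_or_ne q i.castSucc with rfl | h1
          · simp [Fin.ext_iff]
            ring
          rcases eq_or_ne q i.succ with rfl | h2
          · simp [Fin.ext_iff]
            ring
          rw [Equiv.swap_apply_of_ne_of_ne h1 h2, if_neg h1, if_neg h2]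
          ring
        · simp [vertex, middleCoord]
      rw [this]
      exact vertex_mem_tildeP _
  · exact add_mem_tildeP (lastCoord_add_mem_sigmaDual _) (vertex_mem_tildeP s)

lemma facetNormal_nonneg_of_mem_normalCone {s : Equiv.Perm (Fin (r + 1))} {Q : Set (Idx r → ℝ)}
    (hs : vertex s ∈ Q) {u : Idx r → ℝ} (hu : u ∈ normalCone (tildeP r) Q)
    (k : Fin (r + 1) ⊕ Unit) : 0 ≤ facetNormal s k ⬝ᵥ u := by
  have := hu _ hs _ (vertex_add_facetNormal_mem s k)
  rwa [add_dotProduct, le_add_iff_nonneg_right] at this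

/-- A functional attaining its minimum on `P̃^{(n)}` lies in the support of `Δ^{(n)}`. -/
lemma exists_mem_deltaTranslate_of_isMin {x q : Idx r → ℝ} (hq : q ∈ tildeP r)
    (hmin : ∀ p ∈ tildeP r, q ⬝ᵥ x ≤ p ⬝ᵥ x) : ∃ s, x ∈ deltaTranslate r s := by
  -- Moving from the minimum `q` in the recession direction `m` cannot decrease the value.
  have key : ∀ m ∈ sigmaDual r, 0 ≤ m ⬝ᵥ x := fun m hm => by
    have := hmin _ (add_mem_tildeP hm hq)
    rwa [add_dotProduct, le_add_iff_nonneg_right] at this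
  refine exists_mem_deltaTranslate (fun k => ?_) fun k => ?_
  · simpa [sub_dotProduct] using key _ (firstCoord_sub_mem_sigmaDual k)
  · simpa [add_dotProduct] using key _ (lastCoord_add_mem_sigmaDual k)

/-! ### The normal fan and the fan axioms -/

theorem normalFan_tildeP_eq_DeltaFan (r : ℕ) : normalFan (tildeP r) = DeltaFan r := by
  classical
  ext τ
  rw [mem_normalFan_iff]
  constructor
  · rintro ⟨x, ⟨q, hq, hmin⟩, rfl⟩
    obtain ⟨s, hs⟩ := exists_mem_deltaTranslate_of_isMin hq hmin
    have hv : vertex s ∈ {q ∈ tildeP r | ∀ p ∈ tildeP r, q ⬝ᵥ x ≤ p ⬝ᵥ x} :=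
      ⟨vertex_mem_tildeP s, fun p hp => vertex_dotProduct_le hs hp⟩
    refine ⟨s, ?_⟩
    generalize hQ : {q ∈ tildeP r | ∀ p ∈ tildeP r, q ⬝ᵥ x ≤ p ⬝ᵥ x} = Q at hv
    have hQP : Q ⊆ tildeP r := hQ ▸ fun p hp => hp.1
    have hnn : ∀ q ∈ Q, ∀ u ∈ deltaTranslate r s, 0 ≤ (q - vertex s) ⬝ᵥ u := by
      intro q hq u hu
      rw [sub_dotProduct]
      exact sub_nonneg.2 (vertex_dotProduct_le hu (hQP hq))
    rw [deltaTranslate_eq_hull] at hnn ⊢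
    -- Inside `s δ`, where `vertex s` is minimal, the normal cone of `Q` is cut out by requiring
    -- every `q ∈ Q` to have the same value as `vertex s`.
    refine isFace_of_forall (L := (fun q => q - vertex s) '' Q) ?_ fun u => ?_
    · rintro _ ⟨q, hq, rfl⟩ k
      exact hnn q hq _ (Submodule.subset_span ⟨k, rfl⟩)
    · rw [Set.forall_mem_image]
      refine ⟨fun hu => ?_, fun h q hq p hp => ?_⟩
      · have hus : u ∈ PointedCone.hull ℝ (Set.range (ray s)) := by
          rw [← deltaTranslate_eq_hull, mem_deltaTranslate]
          exact facetNormal_nonneg_of_mem_normalCone hv hu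
        refine ⟨hus, fun q hq => le_antisymm ?_ (hnn q hq u hus)⟩
        rw [sub_dotProduct]
        exact sub_nonpos.2 (hu q hq _ (hQP hv))
      · have := h.2 hq
        rw [sub_dotProduct, sub_eq_zero] at this
        rw [this]
        rw [← deltaTranslate_eq_hull] at h
        exact vertex_dotProduct_le h.1 hp
  · intro hτ
    obtain ⟨s, J, rfl⟩ := mem_DeltaFan_iff.1 hτ
    have hray : ∀ k, ray s k ∈ deltaTranslate r s := fun k => by
      rw [deltaTranslate_eq_hull]
      exact Submodule.subset_span ⟨k, rfl⟩
    -- A point in the relative interior of the face generated by `J`; its set of minima will have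
    -- that face as normal cone.
    let x : Idx r → ℝ := ∑ k, if k ∈ J then ray s k else 0
    have hx : ∀ y : Idx r → ℝ, y ⬝ᵥ x = ∑ k, if k ∈ J then y ⬝ᵥ ray s k else 0 := by
      intro y
      rw [dotProduct_sum]
      refine Finset.sum_congr rfl fun k _ => ?_
      split_ifs <;> simp
    have hxs : x ∈ deltaTranslate r s := sum_mem fun k _ => by
      split_ifs
      exacts [hray k, zero_mem _]
    have hv : vertex s ∈ {q ∈ tildeP r | ∀ p ∈ tildeP r, q ⬝ᵥ x ≤ p ⬝ᵥ x} :=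
      ⟨vertex_mem_tildeP s, fun p hp => vertex_dotProduct_le hxs hp⟩
    refine ⟨x, ⟨_, hv⟩, le_antisymm ?_ fun u hu => ?_⟩
    · refine Submodule.span_le.2 ?_
      rintro _ ⟨k, hk, rfl⟩ q ⟨hq, hmin⟩ p hp
      have h0 : (q - vertex s) ⬝ᵥ x = 0 := by
        rw [sub_dotProduct, sub_eq_zero]
        exact le_antisymm (hmin _ hv.1) (hv.2 q hq)
      have hnn : ∀ l, 0 ≤ (q - vertex s) ⬝ᵥ ray s l := fun l => by
        rw [sub_dotProduct]
        exact sub_nonneg.2 (vertex_dotProduct_le (hray l) hq)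
      -- A vanishing sum of nonnegative terms: `q` and `vertex s` agree on each generator in `J`,
      -- not just on `x`.
      rw [hx, Finset.sum_eq_zero_iff_of_nonneg fun l _ => by split_ifs; exacts [hnn l, le_rfl]] at h0
      have h1 := h0 k (Finset.mem_univ k)
      rw [if_pos hk, sub_dotProduct, sub_eq_zero] at h1
      rw [h1]
      exact vertex_dotProduct_le (hray k) hp
    · rw [mem_hull_ray_image]
      refine fun k => ⟨facetNormal_nonneg_of_mem_normalCone hv hu k, fun hk =>
        le_antisymm ?_ (facetNormal_nonneg_of_mem_normalCone hv hu k)⟩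
      have h0 : facetNormal s k ⬝ᵥ x = 0 := by
        rw [hx]
        refine Finset.sum_eq_zero fun l _ => ?_
        split_ifs with hl
        · rw [facetNormal_dotProduct_ray, if_neg]
          rintro rfl
          exact hk hl
        · rfl
      -- For `k ∉ J` the facet normal vanishes on `x`, so this point is another minimum of `x`.
      -- Comparing it with `vertex s` gives the reverse inequality for `u`.
      have hmem : vertex s + facetNormal s k ∈
          {q ∈ tildeP r | ∀ p ∈ tildeP r, q ⬝ᵥ x ≤ p ⬝ᵥ x} := by
        refine ⟨vertex_add_facetNormal_mem s k, fun p hp => ?_⟩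
        rw [add_dotProduct, h0, add_zero]
        exact hv.2 p hp
      have := hu _ hmem _ hv.1
      rwa [add_dotProduct, add_le_iff_nonpos_right] at this

/-- Cones of different translates are hard to intersect by generators. As normal cones of one
polyhedron they meet in a face; the generators are needed only for finiteness. -/
lemma isFace_inf_of_mem_DeltaFan {σ τ : PointedCone ℝ (Idx r → ℝ)} (hσ : σ ∈ DeltaFan r)
    (hτ : τ ∈ DeltaFan r) : IsFace (σ ⊓ τ) σ := by
  obtain ⟨s, J, hJ⟩ := mem_DeltaFan_iff.1 hσ
  rw [← normalFan_tildeP_eq_DeltaFan, mem_normalFan_iff] at hσ hτ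
  obtain ⟨x, hQ, rfl⟩ := hσ
  obtain ⟨y, _, rfl⟩ := hτ
  rw [Set.image_eq_range] at hJ
  exact isFace_normalCone_inf hQ (fun _ h => h.1) (fun _ h => h.1) hJ

theorem isFan_DeltaFan (r : ℕ) : IsFan (DeltaFan r) where
  finite := by
    refine (Set.finite_range fun q : Equiv.Perm (Fin (r + 1)) × Set (Fin (r + 1) ⊕ Unit) =>
      PointedCone.hull ℝ (ray q.1 '' q.2)).subset fun τ hτ => ?_
    obtain ⟨s, J, rfl⟩ := mem_DeltaFan_iff.1 hτ
    exact ⟨(s, J), rfl⟩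
  rational τ hτ := by
    classical
    obtain ⟨s, J, rfl⟩ := mem_DeltaFan_iff.1 hτ
    refine ⟨J.toFinset.image fun k => symAction ℤ r s (deltaRay r k), ?_⟩
    rw [Finset.coe_image, Set.image_image, Set.coe_toFinset]
    rfl
  stronglyConvex τ hτ u hu hu' := by
    obtain ⟨s, J, rfl⟩ := mem_DeltaFan_iff.1 hτ
    rw [mem_hull_ray_image] at hu hu'
    refine eq_zero_of_facetNormal s fun k => le_antisymm ?_ (hu k).1
    have := (hu' k).1
    rwa [dotProduct_neg, Left.nonneg_neg_iff] at this
  face_mem σ hσ τ h := by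
    obtain ⟨s, J, rfl⟩ := mem_DeltaFan_iff.1 hσ
    obtain ⟨J', _, rfl⟩ := h.exists_generators
    exact mem_DeltaFan_iff.2 ⟨s, J', rfl⟩
  inter_face σ hσ τ hτ :=
    ⟨isFace_inf_of_mem_DeltaFan hσ hτ, inf_comm τ σ ▸ isFace_inf_of_mem_DeltaFan hτ hσ⟩

end Permutahedron

end Toric

theorem mainTheorem6 (r : ℕ) :
    Toric.normalFan (Toric.tildeP r) = Toric.DeltaFan r ∧
    ∃ (hP : Toric.IsFan (Toric.normalFan (Toric.tildeP r)))
      (hΔ : Toric.IsFan (Toric.DeltaFan r))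
      (e : Toric.Fan.toricVariety ⟨_, hP⟩ ≅ Toric.Fan.toricVariety ⟨_, hΔ⟩),
      e.hom ≫ Toric.Fan.structureMorphism ⟨_, hΔ⟩ = Toric.Fan.structureMorphism ⟨_, hP⟩ ∧
      ∀ (σ : Toric.normalFan (Toric.tildeP r)) (τ : Toric.DeltaFan r),
        Toric.Fan.torusInclusion ⟨_, hP⟩ σ ≫ e.hom = Toric.Fan.torusInclusion ⟨_, hΔ⟩ τ := by
  have h := Toric.normalFan_tildeP_eq_DeltaFan r
  have hΔ := Toric.isFan_DeltaFan r
  have hP : Toric.IsFan (Toric.normalFan (Toric.tildeP r)) := h ▸ hΔ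
  exact ⟨h, hP, hΔ, Toric.exists_toricVariety_iso h hP hΔ⟩
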